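/- Let $H$ be a (real or complex) Hilbert space and let $\mathcal L(H)$ be the space of bounded linear operators on $H$. For a linear operator $A:D(A)\subseteq H\to H$ and $\tau>0$ with $1/\tau\in\rho(A)$ (that is, $\tfrac1\tau I-A:D(A)\to H$ is bijective with bounded inverse) put $$V_\tau:=(\tau A+I)(\tau A-I)^{-1}\in\mathcal L(H).$$ The cogenerator of a $C_0$-semigroup $(T(t))_{t\ge 0}$ on $H$ with generator $A$ satisfying $1\in\rho(A)$ is the operator $V:=V_1=(A+I)(A-I)^{-1}$. An operator $S\in\mathcal L(H)$ is called contractive if $\|S\|\le 1$, and a $C_0$-semigroup is called contractive if $\|T(t)\|\le 1$ for all $t\ge 0$. **Corollary (Foiaş–Sz.-Nagy theorem).** 1. An operator $V\in\mathcal L(H)$ is the cogenerator of a contractive $C_0$-semigroup on $H$ if and only if $V$ is contractive and $1$ is not an eigenvalue of $V$. 2. Contractivity of $V_\tau$ does not depend on $\tau$: let $A:D(A)\subseteq H\to H$ be a linear operator and let $\sigma,\tau>0$. If $1/\sigma\in\rho(A)$ and $V_\sigma$ is contractive, then $1/\tau\in\rho(A)$ and $V_\tau$ is contractive. -/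

import Mathlib

open Filter Topology
open scoped NNReal

namespace CogeneratorTheory

/-- A `C₀`-semigroup (strongly continuous one-parameter semigroup of bounded linear operators)
on a normed space `X`. -/
structure C0Semigroup (𝕜 X : Type*) [RCLike 𝕜] [NormedAddCommGroup X] [NormedSpace 𝕜 X] where
  /-- the operators `T(t)`, `t ≥ 0` -/
  T : ℝ≥0 → (X →L[𝕜] X)
  map_zero : T 0 = ContinuousLinearMap.id 𝕜 X
  map_add : ∀ s t : ℝ≥0, T (s + t) = (T s).comp (T t)
  continuous_orbit : ∀ x : X, Continuous fun t : ℝ≥0 => T t x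

section

variable {𝕜 X : Type*} [RCLike 𝕜] [NormedAddCommGroup X] [NormedSpace 𝕜 X]

/-- The semigroup is contractive: `‖T(t)‖ ≤ 1` for all `t ≥ 0`. -/
def C0Semigroup.IsContractive (S : C0Semigroup 𝕜 X) : Prop :=
  ∀ t : ℝ≥0, ‖S.T t‖ ≤ 1

/-- The graph of the generator: all `(x, y)` with `(T(h)x - x)/h → y` as `h → 0+`. -/
def C0Semigroup.generatorGraph (S : C0Semigroup 𝕜 X) : Submodule 𝕜 (X × X) where
  carrier := {p | Tendsto (fun h : ℝ≥0 => (((h : ℝ) : 𝕜)⁻¹) • (S.T h p.1 - p.1))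
    (𝓝[>] 0) (𝓝 p.2)}
  add_mem' := by
    intro p q hp hq
    have h := Tendsto.add hp hq
    refine h.congr fun t => ?_
    simp only [Prod.fst_add, _root_.map_add, ← smul_add]
    congr 1
    abel
  zero_mem' := by
    simp
  smul_mem' := by
    intro c p hp
    have h := Tendsto.const_smul hp c
    refine h.congr fun t => ?_
    simp only [Prod.smul_fst, map_smul, ← smul_sub]
    rw [smul_comm]

/-- The (in general unbounded) generator `A` of the semigroup: its domain consists of all `x`
for which `(T(h)x - x)/h` converges as `h → 0+`, and `A x` is that limit. -/
noncomputable def C0Semigroup.generator (S : C0Semigroup 𝕜 X) : X →ₗ.[𝕜] X :=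
  S.generatorGraph.toLinearPMap

/-- The graph of the generator is indeed the set of pairs that was used to define it. -/
theorem C0Semigroup.generator_graph (S : C0Semigroup 𝕜 X) :
    S.generator.graph = S.generatorGraph := by
  refine Submodule.toLinearPMap_graph_eq _ fun p hp h0 => ?_
  have h : Tendsto (fun h : ℝ≥0 => (((h : ℝ) : 𝕜)⁻¹) • (S.T h p.1 - p.1))
    (𝓝[>] 0) (𝓝 p.2) := hp
  rw [h0] at h
  simp only [_root_.map_zero, sub_zero, smul_zero] at h
  exact tendsto_nhds_unique h tendsto_const_nhds

/-- The resolvent set `ρ(A)` of an operator `A : D(A) ⊆ X → X`: all scalars `μ` for which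
`μ I - A : D(A) → X` is a bijection whose inverse `R` is a bounded operator on `X`. -/
def resolventSetOf (A : X →ₗ.[𝕜] X) : Set 𝕜 :=
  {μ | ∃ R : X →L[𝕜] X,
    (∀ x : A.domain, R (μ • (x : X) - A x) = x) ∧
    (∀ y : X, ∃ x : A.domain, (x : X) = R y ∧ μ • (x : X) - A x = y)}

/-- `IsCayleyTransform A τ V` says that `V = V_τ = (τA + I)(τA - I)⁻¹`, where `1/τ ∈ ρ(A)`
(so that `τA - I : D(A) → X` is bijective with bounded inverse): the bounded operator `V` maps
`(τA - I)x` to `(τA + I)x` for every `x ∈ D(A)`, and this determines `V`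
because the vectors `(τA - I)x` exhaust `X`. -/
def IsCayleyTransform (A : X →ₗ.[𝕜] X) (τ : ℝ) (V : X →L[𝕜] X) : Prop :=
  ((τ : 𝕜)⁻¹) ∈ resolventSetOf A ∧
    ∀ x : A.domain, V ((τ : 𝕜) • A x - (x : X)) = (τ : 𝕜) • A x + (x : X)

/-- `V` is the cogenerator `(A + I)(A - I)⁻¹` of the semigroup with generator `A`
(with `1 ∈ ρ(A)`). -/
def C0Semigroup.IsCogenerator (S : C0Semigroup 𝕜 X) (V : X →L[𝕜] X) : Prop :=
  IsCayleyTransform S.generator 1 V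

end

end CogeneratorTheory

/-! Contractivity of `V` is dissipativity of `A` in disguise. If `z = (A - I)x`, then `Vz - z = 2x`
and `Vz + z = 2Ax`, while `‖Ax + x‖ ≤ ‖Ax - x‖` says `re ⟪Ax, x⟫ ≤ 0`. A contractive semigroup has a
dissipative generator, so `‖V‖ ≤ 1`; and `Vz = z` forces `x = 0`.

Conversely, let `A` send `Vz - z` to `Vz + z`. Its domain is dense (`denseRange_sub_one`), and the
bounded operators `-(I + V_r)/(2r)`, formally `A(I - rA)⁻¹`, commute, generate contraction
semigroups and tend to `A` on its domain as `r → 0`. `exists_contractive_semigroup` passes to the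
limit. The limit generator extends `A` and is dissipative; as `I - A` is already onto, it equals
`A`.

Independence of `τ`: `V_τ` is an explicit fractional linear function of `V_σ`, and
`norm_smul_add_smul_le` shows that it preserves contractivity. -/

namespace CogeneratorTheory

/-! ### Limits of contraction semigroups with commuting bounded generators -/

section BanachSpace

variable {𝕜 X : Type*} [RCLike 𝕜] [NormedAddCommGroup X] [NormedSpace 𝕜 X]

/-- The mean value inequality along the nonnegative reals inside `𝕜`. -/
theorem norm_sub_le_of_hasDerivAt_ofReal {f f' : 𝕜 → X} {C t : ℝ} (ht : 0 ≤ t)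
    (hf : ∀ s : ℝ, HasDerivAt f (f' s) (s : 𝕜))
    (hC : ∀ s : ℝ, 0 ≤ s → s ≤ t → ‖f' s‖ ≤ C) :
    ‖f (t : 𝕜) - f 0‖ ≤ C * t := by
  let _ : NormedSpace ℝ X := NormedSpace.restrictScalars ℝ 𝕜 X
  have : IsScalarTower ℝ 𝕜 X := ⟨fun a b c => by
    rw [RCLike.real_smul_eq_coe_mul, mul_smul]; rfl⟩
  have hd : ∀ s : ℝ, HasDerivAt (fun s : ℝ => f (s : 𝕜)) (f' s) s := by
    intro s
    have h1 : HasDerivAt (fun s : ℝ => (s : 𝕜)) 1 s := by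
      simpa using (RCLike.ofRealCLM (K := 𝕜)).hasDerivAt (x := s)
    simpa [Function.comp_def] using (hf s).scomp s h1
  have := norm_image_sub_le_of_norm_deriv_le_segment' (f := fun s : ℝ => f (s : 𝕜))
    (f' := fun s => f' s) (a := 0) (b := t) (C := C)
    (fun s _ => (hd s).hasDerivWithinAt) (fun s hs => hC s hs.1 hs.2.le) t ⟨ht, le_rfl⟩
  simpa using this

theorem hasDerivAt_exp_smul_apply [CompleteSpace X] (A : X →L[𝕜] X) (x : X) (s : 𝕜) :
    HasDerivAt (fun s : 𝕜 => NormedSpace.exp (s • A) x) (NormedSpace.exp (s • A) (A x)) s := by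
  simpa using (hasDerivAt_exp_smul_const A s).clm_apply (hasDerivAt_const s x)

theorem exp_add_of_commute [CompleteSpace X] {A B : X →L[𝕜] X} (h : Commute A B) :
    NormedSpace.exp (A + B) = NormedSpace.exp A * NormedSpace.exp B :=
  NormedSpace.exp_add_of_commute_of_mem_ball (𝕂 := 𝕜) h
    ((NormedSpace.expSeries_radius_eq_top 𝕜 (X →L[𝕜] X)).symm ▸ edist_lt_top _ _)
    ((NormedSpace.expSeries_radius_eq_top 𝕜 (X →L[𝕜] X)).symm ▸ edist_lt_top _ _)

theorem norm_exp_le_exp_norm (A : X →L[𝕜] X) : ‖NormedSpace.exp A‖ ≤ Real.exp ‖A‖ := by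
  rw [NormedSpace.exp_eq_tsum 𝕜, Real.exp_eq_exp_ℝ]
  refine tsum_of_norm_bounded (NormedSpace.expSeries_div_hasSum_exp ‖A‖) fun n => ?_
  have hp : ‖A ^ n‖ ≤ ‖A‖ ^ n := by
    rcases n.eq_zero_or_pos with rfl | hn
    · simp only [pow_zero]
      exact ContinuousLinearMap.norm_id_le
    · exact norm_pow_le' A hn
  rw [norm_smul, norm_inv, RCLike.norm_natCast, div_eq_inv_mul]
  gcongr

/-- The scalar part splits off: the exponential is `e^{-t} exp(-tB)`, of norm at most `e^{-t}
e^{t}`. -/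
theorem norm_exp_smul_sub_one_le [CompleteSpace X] {B : X →L[𝕜] X} (hB : ‖B‖ ≤ 1) {t : ℝ}
    (ht : 0 ≤ t) : ‖NormedSpace.exp ((t : 𝕜) • (-(1 + B)))‖ ≤ 1 := by
  have h1 : (t : 𝕜) • (-(1 + B)) = algebraMap 𝕜 (X →L[𝕜] X) (-(t : 𝕜)) + (-(t : 𝕜)) • B := by
    rw [Algebra.algebraMap_eq_smul_one]
    simp only [smul_neg, smul_add, neg_smul, neg_add]
  have h2 : NormedSpace.exp (algebraMap 𝕜 (X →L[𝕜] X) (-(t : 𝕜)))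
      = algebraMap 𝕜 (X →L[𝕜] X) ((Real.exp (-t) : ℝ) : 𝕜) := by
    have h := NormedSpace.algebraMap_exp_comm_of_mem_ball (𝕂 := ℝ) (𝔸 := 𝕜) (-t)
      ((NormedSpace.expSeries_radius_eq_top ℝ ℝ).symm ▸ edist_lt_top _ _)
    have h' := NormedSpace.algebraMap_exp_comm_of_mem_ball (𝕂 := 𝕜) (𝔸 := X →L[𝕜] X) (-(t : 𝕜))
      ((NormedSpace.expSeries_radius_eq_top 𝕜 𝕜).symm ▸ edist_lt_top _ _)
    rw [← h', Real.exp_eq_exp_ℝ]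
    congr 1
    simpa using h.symm
  rw [h1, exp_add_of_commute (Algebra.commute_algebraMap_left _ _), h2, Algebra.algebraMap_eq_smul_one,
    smul_one_mul, norm_smul, RCLike.norm_ofReal, abs_of_pos (Real.exp_pos _)]
  calc Real.exp (-t) * ‖NormedSpace.exp (-(t : 𝕜) • B)‖
      ≤ Real.exp (-t) * Real.exp t := by
        gcongr
        refine (norm_exp_le_exp_norm _).trans (Real.exp_le_exp.2 ?_)
        rw [norm_smul, norm_neg, RCLike.norm_ofReal, abs_of_nonneg ht]
        exact mul_le_of_le_one_right ht hB
    _ = 1 := by rw [← Real.exp_add]; simp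

/-- `A` is the generator of a contraction semigroup `t ↦ exp (t A)`. -/
def ExpContractive (A : X →L[𝕜] X) : Prop :=
  ∀ t : ℝ, 0 ≤ t → ‖NormedSpace.exp ((t : 𝕜) • A)‖ ≤ 1

theorem ExpContractive.norm_apply_le {A : X →L[𝕜] X} (hA : ExpContractive A) {t : ℝ}
    (ht : 0 ≤ t) (x : X) : ‖NormedSpace.exp ((t : 𝕜) • A) x‖ ≤ ‖x‖ := by
  simpa using ContinuousLinearMap.le_of_opNorm_le _ (hA t ht) x

variable [CompleteSpace X]

/-- Interpolate between the two semigroups by `s ↦ exp(tB) exp(s(A - B)) x` for `0 ≤ s ≤ t` and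
bound the derivative. -/
theorem ExpContractive.norm_sub_apply_le {A B : X →L[𝕜] X} (hA : ExpContractive A)
    (hB : ExpContractive B) (hAB : Commute A B) {t : ℝ} (ht : 0 ≤ t) (x : X) :
    ‖NormedSpace.exp ((t : 𝕜) • A) x - NormedSpace.exp ((t : 𝕜) • B) x‖ ≤ ‖A x - B x‖ * t := by
  have hd : ∀ s : ℝ, HasDerivAt
      (fun s : 𝕜 => NormedSpace.exp ((t : 𝕜) • B) (NormedSpace.exp (s • (A - B)) x))
      (NormedSpace.exp ((t : 𝕜) • B) (NormedSpace.exp ((s : 𝕜) • (A - B)) ((A - B) x)))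
      (s : 𝕜) := fun s =>
    (NormedSpace.exp ((t : 𝕜) • B)).hasFDerivAt.comp_hasDerivAt (s : 𝕜)
      (hasDerivAt_exp_smul_apply (A - B) x (s : 𝕜))
  -- By commutativity the path is a product of exponentials at the nonnegative times `s` and `t -
  -- s`, hence contractive.
  have hsplit : ∀ (s : ℝ) (y : X),
      NormedSpace.exp ((t : 𝕜) • B) (NormedSpace.exp ((s : 𝕜) • (A - B)) y)
        = NormedSpace.exp ((s : 𝕜) • A) (NormedSpace.exp (((t - s : ℝ) : 𝕜) • B) y) := by
    intro s y
    have h1 : Commute ((t : 𝕜) • B) ((s : 𝕜) • (A - B)) :=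
      ((hAB.symm.sub_right (Commute.refl B)).smul_left _).smul_right _
    have h2 : Commute ((s : 𝕜) • A) (((t - s : ℝ) : 𝕜) • B) := (hAB.smul_left _).smul_right _
    rw [← mul_apply_eq_comp, ← mul_apply_eq_comp,
      ← exp_add_of_commute h1, ← exp_add_of_commute h2]
    congr 2
    push_cast
    module
  have := norm_sub_le_of_hasDerivAt_ofReal (f' := fun s : 𝕜 =>
    NormedSpace.exp ((t : 𝕜) • B) (NormedSpace.exp (s • (A - B)) ((A - B) x)))
    (C := ‖A x - B x‖) ht hd (fun s hs hst => by
      rw [hsplit]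
      refine (hA.norm_apply_le hs _).trans ((hB.norm_apply_le (sub_nonneg.2 hst) _).trans ?_)
      simp)
  rw [hsplit] at this
  simpa using this

theorem ExpContractive.norm_apply_sub_self_le {A : X →L[𝕜] X} (hA : ExpContractive A) {t : ℝ}
    (ht : 0 ≤ t) (x : X) : ‖NormedSpace.exp ((t : 𝕜) • A) x - x‖ ≤ ‖A x‖ * t := by
  have h0 : ExpContractive (0 : X →L[𝕜] X) := fun t _ => by
    simp only [smul_zero, NormedSpace.exp_zero]
    exact ContinuousLinearMap.norm_id_le
  simpa using hA.norm_sub_apply_le h0 (Commute.zero_right A) ht x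

/-- In the limit `y` is the generator's value at `x` and need not lie in its domain, so `‖A y‖` may
be uncontrolled. A nearby `y'` with controlled `A y'` replaces it. -/
theorem ExpContractive.norm_apply_sub_self_sub_smul_le {A : X →L[𝕜] X} (hA : ExpContractive A)
    {t : ℝ} (ht : 0 ≤ t) (x y y' : X) :
    ‖NormedSpace.exp ((t : 𝕜) • A) x - x - (t : 𝕜) • y‖
      ≤ (‖A x - y‖ + 2 * ‖y - y'‖ + ‖A y'‖ * t) * t := by
  have hd : ∀ s : ℝ, HasDerivAt (fun s : 𝕜 => NormedSpace.exp (s • A) x - s • y)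
      (NormedSpace.exp ((s : 𝕜) • A) (A x) - y) (s : 𝕜) := fun s => by
    simpa using (hasDerivAt_exp_smul_apply A x (s : 𝕜)).fun_sub
      ((hasDerivAt_id' (s : 𝕜)).smul_const y)
  have := norm_sub_le_of_hasDerivAt_ofReal
    (f' := fun s : 𝕜 => NormedSpace.exp (s • A) (A x) - y)
    (C := ‖A x - y‖ + 2 * ‖y - y'‖ + ‖A y'‖ * t) ht hd (fun s hs hst => by
      set E := NormedSpace.exp ((s : 𝕜) • A)
      have e : E (A x) - y = E (A x - y) + E (y - y') + (E y' - y') + (y' - y) := by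
        simp only [map_sub]; abel
      rw [e]
      have h1 : ‖E (A x - y)‖ ≤ ‖A x - y‖ := hA.norm_apply_le hs _
      have h2 : ‖E (y - y')‖ ≤ ‖y - y'‖ := hA.norm_apply_le hs _
      have h3 : ‖E y' - y'‖ ≤ ‖A y'‖ * t :=
        (hA.norm_apply_sub_self_le hs y').trans (by gcongr)
      have h4 : ‖y' - y‖ = ‖y - y'‖ := norm_sub_rev _ _
      refine (norm_add_le_of_le (norm_add_le_of_le (norm_add_le_of_le h1 h2) h3) h4.le).trans ?_
      linarith)
  simpa [sub_right_comm] using this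

/-- Pointwise convergence of contractions on a dense set extends to the whole space. -/
theorem exists_tendsto_of_dense {E : ℕ → X →L[𝕜] X} (hE : ∀ n, ‖E n‖ ≤ 1) {D : Set X}
    (hD : Dense D) (h : ∀ x ∈ D, CauchySeq fun n => E n x) (x : X) :
    ∃ y, Tendsto (fun n => E n x) atTop (𝓝 y) := by
  have hle : ∀ n z, ‖E n z‖ ≤ ‖z‖ := fun n z => by
    simpa using ContinuousLinearMap.le_of_opNorm_le _ (hE n) z
  refine cauchySeq_tendsto_of_complete (Metric.cauchySeq_iff.2 fun ε hε => ?_)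
  obtain ⟨z, hz, hxz⟩ := hD.exists_dist_lt x (show 0 < ε / 3 by positivity)
  obtain ⟨N, hN⟩ := Metric.cauchySeq_iff.1 (h z hz) (ε / 3) (by positivity)
  refine ⟨N, fun m hm n hn => ?_⟩
  have h1 := hN m hm n hn
  rw [dist_eq_norm] at *
  have e : E m x - E n x = E m (x - z) + (E m z - E n z) - E n (x - z) := by
    simp only [map_sub]; abel
  rw [e]
  refine (norm_sub_le_of_le (norm_add_le_of_le (hle m _) le_rfl) (hle n _)).trans_lt ?_
  linarith

/-- A version of the Trotter–Kato approximation theorem: if commuting bounded operators `A n`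
generate contraction semigroups and converge pointwise on a dense set, then their semigroups
converge to a contraction semigroup whose generator extends the pointwise limit of `A n`. -/
theorem exists_contractive_semigroup {A : ℕ → X →L[𝕜] X} (hA : ∀ n, ExpContractive (A n))
    (hcomm : ∀ m n, Commute (A m) (A n))
    (hdense : Dense {x | ∃ y, Tendsto (fun n => A n x) atTop (𝓝 y)}) :
    ∃ S : C0Semigroup 𝕜 X, S.IsContractive ∧
      ∀ x y, Tendsto (fun n => A n x) atTop (𝓝 y) → (x, y) ∈ S.generatorGraph := by
  set E : ℝ≥0 → ℕ → X →L[𝕜] X := fun t n => NormedSpace.exp (((t : ℝ) : 𝕜) • A n) with hEdef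
  have hE : ∀ t n, ‖E t n‖ ≤ 1 := fun t n => hA n t t.2
  have hEle : ∀ t n x, ‖E t n x‖ ≤ ‖x‖ := fun t n x => (hA n).norm_apply_le t.2 x
  have hlim : ∀ t x, ∃ y, Tendsto (fun n => E t n x) atTop (𝓝 y) := by
    intro t
    refine exists_tendsto_of_dense (hE t) hdense ?_
    rintro x ⟨y, hy⟩
    refine Metric.cauchySeq_iff.2 fun ε hε => ?_
    obtain ⟨N, hN⟩ := Metric.cauchySeq_iff.1 hy.cauchySeq (ε / (t + 1)) (by positivity)
    refine ⟨N, fun m hm n hn => ?_⟩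
    have h1 := hN m hm n hn
    rw [dist_eq_norm] at *
    rw [lt_div_iff₀ (by positivity)] at h1
    refine ((hA m).norm_sub_apply_le (hA n) (hcomm m n) t.2 x).trans_lt (lt_of_le_of_lt ?_ h1)
    gcongr
    simp
  choose L hL using hlim
  have hadd : ∀ t x y, L t (x + y) = L t x + L t y := fun t x y =>
    tendsto_nhds_unique (hL t (x + y)) (by simpa using (hL t x).add (hL t y))
  have hsmul : ∀ t (c : 𝕜) x, L t (c • x) = c • L t x := fun t c x =>
    tendsto_nhds_unique (hL t (c • x)) (by simpa using (hL t x).const_smul c)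
  have hLle : ∀ t x, ‖L t x‖ ≤ ‖x‖ := fun t x =>
    le_of_tendsto (hL t x).norm (Eventually.of_forall fun n => hEle t n x)
  set T : ℝ≥0 → X →L[𝕜] X := fun t =>
    LinearMap.mkContinuous ⟨⟨L t, hadd t⟩, hsmul t⟩ 1 (fun x => by simpa using hLle t x) with hT
  have hTL : ∀ t x, T t x = L t x := fun t x => rfl
  have hcontr : ∀ t, ‖T t‖ ≤ 1 := fun t => LinearMap.mkContinuous_norm_le _ zero_le_one _
  have hT0 : T 0 = ContinuousLinearMap.id 𝕜 X := by
    ext x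
    refine tendsto_nhds_unique (hL 0 x) ?_
    simp [hEdef]
  have hTadd : ∀ s t, T (s + t) = (T s).comp (T t) := by
    intro s t
    ext x
    refine tendsto_nhds_unique (hL (s + t) x) ?_
    -- `E s n` acts on a vector that moves with `n`; uniform contractivity absorbs the movement.
    have h1 : ∀ n, E (s + t) n x = E s n (E t n x - L t x) + E s n (L t x) := by
      intro n
      have h2 : E (s + t) n = E s n * E t n := by
        rw [hEdef]
        simp only
        rw [← exp_add_of_commute (((Commute.refl (A n)).smul_left _).smul_right _), ← add_smul]
        push_cast
        rfl
      rw [h2, ← map_add, sub_add_cancel]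
      rfl
    have h3 : Tendsto (fun n => E s n (E t n x - L t x)) atTop (𝓝 0) :=
      squeeze_zero_norm (fun n => hEle s n _)
        (by simpa using ((hL t x).sub_const (L t x)).norm)
    simp only [h1]
    rw [ContinuousLinearMap.comp_apply, hTL, hTL]
    convert h3.add (hL s (L t x)) using 2
    exact (zero_add _).symm
  have hest : ∀ x y y' z', Tendsto (fun n => A n x) atTop (𝓝 y) →
      Tendsto (fun n => A n y') atTop (𝓝 z') → ∀ t : ℝ≥0,
      ‖T t x - x - ((t : ℝ) : 𝕜) • y‖ ≤ (2 * ‖y - y'‖ + ‖z'‖ * t) * t := by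
    intro x y y' z' hx hy' t
    have h1 : Tendsto (fun n => (‖A n x - y‖ + 2 * ‖y - y'‖ + ‖A n y'‖ * (t : ℝ)) * (t : ℝ)) atTop
        (𝓝 ((‖y - y‖ + 2 * ‖y - y'‖ + ‖z'‖ * t) * t)) :=
      ((((hx.sub_const y).norm.add_const _).add (hy'.norm.mul_const _)).mul_const _)
    rw [sub_self, norm_zero, zero_add] at h1
    exact le_of_tendsto_of_tendsto (((hL t x).sub_const x).sub_const _).norm h1
      (Eventually.of_forall fun n => (hA n).norm_apply_sub_self_sub_smul_le t.2 x y y')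
  have hgen : ∀ x y, Tendsto (fun n => A n x) atTop (𝓝 y) →
      Tendsto (fun h : ℝ≥0 => (((h : ℝ) : 𝕜)⁻¹) • (T h x - x)) (𝓝[>] 0) (𝓝 y) := by
    intro x y hx
    rw [Metric.tendsto_nhds]
    intro ε hε
    obtain ⟨y', ⟨z', hz'⟩, hyy'⟩ := hdense.exists_dist_lt y (show 0 < ε / 4 by positivity)
    rw [dist_eq_norm] at hyy'
    have hc : Tendsto (fun t : ℝ≥0 => 2 * ‖y - y'‖ + ‖z'‖ * (t : ℝ)) (𝓝[>] 0)
        (𝓝 (2 * ‖y - y'‖ + ‖z'‖ * ((0 : ℝ≥0) : ℝ))) :=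
      (Continuous.tendsto (by fun_prop) _).mono_left nhdsWithin_le_nhds
    have hlt : 2 * ‖y - y'‖ + ‖z'‖ * ((0 : ℝ≥0) : ℝ) < ε := by
      rw [NNReal.coe_zero, mul_zero]; linarith
    filter_upwards [hc.eventually_lt_const hlt, self_mem_nhdsWithin] with t ht ht0
    have ht0' : (0 : ℝ) < t := ht0
    have hne : ((t : ℝ) : 𝕜) ≠ 0 := by exact_mod_cast ht0'.ne'
    have e : (((t : ℝ) : 𝕜)⁻¹) • (T t x - x) - y
        = (((t : ℝ) : 𝕜)⁻¹) • (T t x - x - ((t : ℝ) : 𝕜) • y) := by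
      rw [smul_sub _ (T t x - x), inv_smul_smul₀ hne]
    rw [dist_eq_norm, e, norm_smul, norm_inv, RCLike.norm_ofReal, abs_of_pos ht0',
      inv_mul_lt_iff₀ ht0', mul_comm]
    exact (hest x y y' z' hx hz' t).trans_lt (by gcongr)
  have hlip : ∀ x y, Tendsto (fun n => A n x) atTop (𝓝 y) →
      ∀ t : ℝ≥0, ‖T t x - x‖ ≤ ‖y‖ * t := fun x y hx t =>
    le_of_tendsto_of_tendsto ((hL t x).sub_const x).norm (hx.norm.mul_const _)
      (Eventually.of_forall fun n => (hA n).norm_apply_sub_self_le t.2 x)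
  have hTle : ∀ t x, ‖T t x‖ ≤ ‖x‖ := hLle
  have hlip' : ∀ x y, Tendsto (fun n => A n x) atTop (𝓝 y) →
      ∀ s t : ℝ≥0, s ≤ t → ‖T t x - T s x‖ ≤ ‖y‖ * dist t s := by
    intro x y hx s t hst
    obtain ⟨u, rfl⟩ := exists_add_of_le hst
    rw [hTadd, ContinuousLinearMap.comp_apply, ← map_sub]
    refine (hTle _ _).trans ((hlip x y hx u).trans_eq ?_)
    simp [NNReal.dist_eq]
  have hcont : ∀ x, Continuous fun t : ℝ≥0 => T t x := by
    intro x
    -- Orbits of the dense set are Lipschitz, and by contractivity they approximate the orbit of `x`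
    -- uniformly in time.
    refine continuous_of_uniform_approx_of_continuous fun u hu => ?_
    obtain ⟨ε, hε, hεu⟩ := Metric.mem_uniformity_dist.1 hu
    obtain ⟨z, ⟨y, hy⟩, hxz⟩ := hdense.exists_dist_lt x hε
    refine ⟨fun t => T t z, ?_, fun t => hεu ?_⟩
    · refine (LipschitzWith.of_dist_le_mul (K := ‖y‖₊) fun t s => ?_).continuous
      rw [dist_eq_norm, coe_nnnorm]
      rcases le_total s t with h | h
      · exact hlip' z y hy s t h
      · rw [norm_sub_rev, dist_comm]
        exact hlip' z y hy t s h
    · rw [dist_eq_norm, ← map_sub]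
      rw [dist_eq_norm] at hxz
      exact (hTle t _).trans_lt hxz
  exact ⟨⟨T, hT0, hTadd, hcont⟩, hcontr, hgen⟩

end BanachSpace

/-! ### Dissipativity and the necessary conditions -/

section HilbertSpace

variable {𝕜 H : Type*} [RCLike 𝕜] [NormedAddCommGroup H] [InnerProductSpace 𝕜 H]

theorem norm_add_le_norm_sub {x y : H} (h : RCLike.re (inner 𝕜 y x) ≤ 0) :
    ‖y + x‖ ≤ ‖y - x‖ := by
  refine le_of_sq_le_sq ?_ (norm_nonneg _)
  rw [@norm_add_sq 𝕜, @norm_sub_sq 𝕜]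
  linarith

/-- The cross terms agree, so the squared norms differ by `4r(‖x‖² - ‖y‖²)`. -/
theorem norm_smul_add_smul_le {x y : H} (h : ‖y‖ ≤ ‖x‖) {r : ℝ} (hr : 0 ≤ r) :
    ‖((r + 1 : ℝ) : 𝕜) • y + ((r - 1 : ℝ) : 𝕜) • x‖
      ≤ ‖((r + 1 : ℝ) : 𝕜) • x + ((r - 1 : ℝ) : 𝕜) • y‖ := by
  refine le_of_sq_le_sq ?_ (norm_nonneg _)
  have h2 : ‖y‖ ^ 2 ≤ ‖x‖ ^ 2 := by gcongr
  have hs : RCLike.re (inner 𝕜 y x) = RCLike.re (inner 𝕜 x y) := inner_re_symm _ _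
  rw [@norm_add_sq 𝕜, @norm_add_sq 𝕜]
  simp only [inner_smul_left, inner_smul_right, RCLike.conj_ofReal, RCLike.re_ofReal_mul, hs,
    norm_smul, mul_pow, RCLike.norm_ofReal, sq_abs]
  nlinarith [mul_le_mul_of_nonneg_left h2 hr]

/-- The generator of a contraction semigroup on a Hilbert space is dissipative. -/
theorem C0Semigroup.IsContractive.re_inner_le {S : C0Semigroup 𝕜 H} (hS : S.IsContractive)
    {x y : H} (h : (x, y) ∈ S.generatorGraph) : RCLike.re (inner 𝕜 y x) ≤ 0 := by
  have h1 : Tendsto (fun h : ℝ≥0 => (((h : ℝ) : 𝕜)⁻¹) • (S.T h x - x)) (𝓝[>] 0) (𝓝 y) := h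
  have h2 := (RCLike.continuous_re.tendsto _).comp (h1.inner (𝕜 := 𝕜) (tendsto_const_nhds (x := x)))
  refine le_of_tendsto h2 (Eventually.of_forall fun t => ?_)
  have h3 : RCLike.re (inner 𝕜 (S.T t x) x) ≤ ‖x‖ * ‖x‖ := by
    refine (re_inner_le_norm _ _).trans ?_
    gcongr
    simpa using ContinuousLinearMap.le_of_opNorm_le _ (hS t) x
  simp only [Function.comp_apply]
  rw [← RCLike.ofReal_inv, inner_smul_left, RCLike.conj_ofReal, RCLike.re_ofReal_mul,
    inner_sub_left, _root_.map_sub, inner_self_eq_norm_mul_norm]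
  exact mul_nonpos_of_nonneg_of_nonpos (by positivity) (by linarith)

theorem exists_smul_sub_eq {A : H →ₗ.[𝕜] H} {τ : ℝ} (hτ : 0 < τ)
    (h : ((τ : 𝕜)⁻¹) ∈ resolventSetOf A) (z : H) :
    ∃ x : A.domain, (τ : 𝕜) • A x - (x : H) = z := by
  obtain ⟨R, -, hR⟩ := h
  have hne : (τ : 𝕜) ≠ 0 := by exact_mod_cast hτ.ne'
  obtain ⟨x, -, hx⟩ := hR (-((τ : 𝕜)⁻¹ • z))
  refine ⟨x, ?_⟩
  have h1 : (τ : 𝕜) • ((τ : 𝕜)⁻¹ • (x : H) - A x) = -z := by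
    rw [hx, smul_neg, smul_inv_smul₀ hne]
  rw [smul_sub, smul_inv_smul₀ hne] at h1
  rw [← neg_sub, h1, neg_neg]

theorem C0Semigroup.IsCogenerator.norm_le_one {S : C0Semigroup 𝕜 H} (hS : S.IsContractive)
    {V : H →L[𝕜] H} (hV : S.IsCogenerator V) : ‖V‖ ≤ 1 := by
  refine ContinuousLinearMap.opNorm_le_bound _ zero_le_one fun z => ?_
  obtain ⟨x, rfl⟩ := exists_smul_sub_eq one_pos hV.1 z
  have hx : ((x : H), S.generator x) ∈ S.generatorGraph := by
    rw [← S.generator_graph]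
    exact S.generator.mem_graph x
  rw [hV.2]
  simpa using norm_add_le_norm_sub (hS.re_inner_le hx)

theorem C0Semigroup.IsCogenerator.not_hasEigenvalue_one {S : C0Semigroup 𝕜 H}
    {V : H →L[𝕜] H} (hV : S.IsCogenerator V) :
    ¬ Module.End.HasEigenvalue (V : H →ₗ[𝕜] H) 1 := by
  intro h
  obtain ⟨z, hz, hz0⟩ := h.exists_hasEigenvector
  rw [Module.End.mem_eigenspace_iff, one_smul, ContinuousLinearMap.coe_coe] at hz
  obtain ⟨x, rfl⟩ := exists_smul_sub_eq one_pos hV.1 z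
  rw [hV.2] at hz
  have h2 : (2 : 𝕜) • (x : H) = 0 := by
    rw [two_smul, ← sub_eq_zero.2 hz]
    abel
  have hx : x = 0 := Subtype.ext ((smul_eq_zero.1 h2).resolve_left two_ne_zero)
  exact hz0 (by simp [hx])

/-! ### Changing the parameter of the Cayley transform -/

/-- For a contraction `V`, the operator `((r + 1) I + (r - 1) V)⁻¹`. -/
noncomputable def cayleyInv (V : H →L[𝕜] H) (r : ℝ) : H →L[𝕜] H :=
  Ring.inverse (((r + 1 : ℝ) : 𝕜) • (1 : H →L[𝕜] H) + ((r - 1 : ℝ) : 𝕜) • V)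

/-- If `V = V_σ`, this is `V_{r σ} = ((r + 1) V + (r - 1) I) ((r + 1) I + (r - 1) V)⁻¹`. -/
noncomputable def cayleyRescale (V : H →L[𝕜] H) (r : ℝ) : H →L[𝕜] H :=
  (((r + 1 : ℝ) : 𝕜) • V + ((r - 1 : ℝ) : 𝕜) • (1 : H →L[𝕜] H)) * cayleyInv V r

theorem _root_.Commute.ringInverse_right {M : Type*} [MonoidWithZero M] {a b : M}
    (h : Commute a b) : Commute a (Ring.inverse b) := by
  by_cases hb : IsUnit b
  · obtain ⟨u, rfl⟩ := hb
    rw [Ring.inverse_unit]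
    exact h.units_inv_right
  · rw [Ring.inverse_non_unit _ hb]
    exact Commute.zero_right a

theorem commute_cayleyRescale_of_commute {V B : H →L[𝕜] H} (h : Commute B V) (r : ℝ) :
    Commute B (cayleyRescale V r) :=
  ((h.smul_right _).add_right ((Commute.one_right B).smul_right _)).mul_right
    (((Commute.one_right B).smul_right _).add_right (h.smul_right _)).ringInverse_right

theorem commute_cayleyRescale (V : H →L[𝕜] H) (r s : ℝ) :
    Commute (cayleyRescale V r) (cayleyRescale V s) :=
  commute_cayleyRescale_of_commute (commute_cayleyRescale_of_commute (Commute.refl V) r).symm s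

variable [CompleteSpace H]

/-- Neumann series, since `|1 - r| / (r + 1) < 1`. -/
theorem isUnit_smul_one_add_smul {V : H →L[𝕜] H} (hV : ‖V‖ ≤ 1) {r : ℝ} (hr : 0 < r) :
    IsUnit (((r + 1 : ℝ) : 𝕜) • (1 : H →L[𝕜] H) + ((r - 1 : ℝ) : 𝕜) • V) := by
  have hne : ((r + 1 : ℝ) : 𝕜) ≠ 0 := by
    exact_mod_cast (show r + 1 ≠ 0 by positivity)
  have e : ((r + 1 : ℝ) : 𝕜) • (1 : H →L[𝕜] H) + ((r - 1 : ℝ) : 𝕜) • V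
      = ((r + 1 : ℝ) : 𝕜) • (1 - (((1 - r) / (r + 1) : ℝ) : 𝕜) • V) := by
    rw [smul_sub, smul_smul, ← RCLike.ofReal_mul, mul_div_cancel₀ _ (by positivity),
      ← neg_sub 1 r, RCLike.ofReal_neg, neg_smul, ← sub_eq_add_neg]
  rw [e]
  rw [← smul_one_mul]
  refine IsUnit.mul ?_ (isUnit_one_sub_of_norm_lt_one ?_)
  · rw [← Algebra.algebraMap_eq_smul_one]
    exact (IsUnit.mk0 _ hne).map _
  rw [norm_smul, RCLike.norm_ofReal]
  refine (mul_le_of_le_one_right (abs_nonneg _) hV).trans_lt ?_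
  rw [abs_lt, lt_div_iff₀ (by positivity), div_lt_iff₀ (by positivity)]
  constructor <;> linarith

theorem cayleyInv_apply_right {V : H →L[𝕜] H} (hV : ‖V‖ ≤ 1) {r : ℝ} (hr : 0 < r) (z : H) :
    ((r + 1 : ℝ) : 𝕜) • cayleyInv V r z + ((r - 1 : ℝ) : 𝕜) • V (cayleyInv V r z) = z := by
  simpa [cayleyInv] using DFunLike.congr_fun
    (Ring.mul_inverse_cancel _ (isUnit_smul_one_add_smul hV hr)) z

theorem cayleyInv_apply_left {V : H →L[𝕜] H} (hV : ‖V‖ ≤ 1) {r : ℝ} (hr : 0 < r) (z : H) :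
    cayleyInv V r (((r + 1 : ℝ) : 𝕜) • z + ((r - 1 : ℝ) : 𝕜) • V z) = z := by
  simpa [cayleyInv] using DFunLike.congr_fun
    (Ring.inverse_mul_cancel _ (isUnit_smul_one_add_smul hV hr)) z

theorem norm_cayleyRescale_le {V : H →L[𝕜] H} (hV : ‖V‖ ≤ 1) {r : ℝ} (hr : 0 < r) :
    ‖cayleyRescale V r‖ ≤ 1 := by
  refine ContinuousLinearMap.opNorm_le_bound _ zero_le_one fun z => ?_
  rw [one_mul]
  conv_rhs => rw [← cayleyInv_apply_right hV hr z]
  exact norm_smul_add_smul_le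
    (by simpa using ContinuousLinearMap.le_of_opNorm_le _ hV (cayleyInv V r z)) hr.le

/-- With `z = (σA - I)x`, both `2x = Vz - z` and `2σAx = Vz + z` are combinations of `z` and `Vz`,
hence so are `2(τA ± I)x`. -/
theorem IsCayleyTransform.rescale {A : H →ₗ.[𝕜] H} {σ τ : ℝ} (hσ : 0 < σ) (hτ : 0 < τ)
    {V : H →L[𝕜] H} (hA : IsCayleyTransform A σ V) (hV : ‖V‖ ≤ 1) :
    IsCayleyTransform A τ (cayleyRescale V (τ / σ)) := by
  have hr : 0 < τ / σ := div_pos hτ hσ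
  have hσ0 : (σ : 𝕜) ≠ 0 := by exact_mod_cast hσ.ne'
  have hτ0 : (τ : 𝕜) ≠ 0 := by exact_mod_cast hτ.ne'
  have hkey : ∀ x : A.domain, (2 : 𝕜) • ((τ : 𝕜) • A x - (x : H)) =
      (((τ / σ + 1 : ℝ) : 𝕜) • ((σ : 𝕜) • A x - (x : H))
        + ((τ / σ - 1 : ℝ) : 𝕜) • V ((σ : 𝕜) • A x - (x : H))) := by
    intro x
    rw [hA.2]
    push_cast
    match_scalars <;> field_simp <;> ring
  have hinv : ∀ x : A.domain, (2 : 𝕜) • cayleyInv V (τ / σ) ((τ : 𝕜) • A x - (x : H))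
      = (σ : 𝕜) • A x - (x : H) := by
    intro x
    rw [← map_smul, hkey, cayleyInv_apply_left hV hr]
  have hx : ∀ x : A.domain, V ((σ : 𝕜) • A x - (x : H)) - ((σ : 𝕜) • A x - (x : H))
      = (2 : 𝕜) • (x : H) := by
    intro x
    rw [hA.2]
    module
  -- The resolvent at `1/τ` is `-τ(τA - I)⁻¹`, and `(τA - I)⁻¹ = (V - I) cayleyInv V (τ/σ)`.
  refine ⟨⟨(-(τ : 𝕜)) • ((V - 1) * cayleyInv V (τ / σ)), fun x => ?_, fun y => ?_⟩, fun x => ?_⟩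
  · have e : (τ : 𝕜)⁻¹ • (x : H) - A x = (-(τ : 𝕜)⁻¹) • ((τ : 𝕜) • A x - (x : H)) := by
      match_scalars <;> field_simp
    have h2 := hx x
    rw [← hinv x, map_smul, ← smul_sub] at h2
    have h3 := smul_right_injective H (two_ne_zero (α := 𝕜)) h2
    rw [e, map_smul, smul_apply, smul_smul, neg_mul_neg, inv_mul_cancel₀ hτ0,
      one_smul]
    exact h3
  · obtain ⟨x, hx'⟩ := exists_smul_sub_eq hσ hA.1
      ((2 : 𝕜) • cayleyInv V (τ / σ) (-((τ : 𝕜) • y)))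
    have h1 : (τ : 𝕜) • A x - (x : H) = -((τ : 𝕜) • y) := by
      have := hkey x
      rw [hx', map_smul, smul_comm _ (2 : 𝕜), smul_comm _ (2 : 𝕜), ← smul_add,
        cayleyInv_apply_right hV hr] at this
      exact smul_right_injective H (two_ne_zero (α := 𝕜)) this
    refine ⟨x, ?_, ?_⟩
    · have h2 := hx x
      rw [hx', map_smul, ← smul_sub] at h2
      have h3 := smul_right_injective H (two_ne_zero (α := 𝕜)) h2
      rw [← h3]
      simp [smul_sub]
      abel
    · have e : (τ : 𝕜)⁻¹ • (x : H) - A x = (-(τ : 𝕜)⁻¹) • ((τ : 𝕜) • A x - (x : H)) := by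
        match_scalars <;> field_simp
      rw [e, h1, smul_neg, neg_smul, neg_neg, inv_smul_smul₀ hτ0]
  · refine smul_right_injective H (two_ne_zero (α := 𝕜)) ?_
    simp only
    rw [← map_smul]
    have h1 : cayleyRescale V (τ / σ) ((2 : 𝕜) • ((τ : 𝕜) • A x - (x : H)))
        = ((τ / σ + 1 : ℝ) : 𝕜) • V ((σ : 𝕜) • A x - (x : H))
          + ((τ / σ - 1 : ℝ) : 𝕜) • ((σ : 𝕜) • A x - (x : H)) := by
      rw [← hinv x, map_smul]
      simp only [cayleyRescale, mul_apply_eq_comp, add_apply,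
        smul_apply, one_apply_eq_self, smul_add, map_smul]
      simp only [smul_comm (2 : 𝕜)]
    rw [h1, hA.2]
    push_cast
    match_scalars <;> field_simp <;> ring

/-! ### Constructing the semigroup from `V` -/

/-- If `1` is not an eigenvalue of a contraction `V`, then `(V + I)(V - I)⁻¹` is densely
defined. -/
theorem denseRange_sub_one {V : H →L[𝕜] H} (hV : ‖V‖ ≤ 1)
    (h1 : ¬ Module.End.HasEigenvalue (V : H →ₗ[𝕜] H) 1) : DenseRange fun z => V z - z := by
  have hbot : (LinearMap.range ((V - 1 : H →L[𝕜] H) : H →ₗ[𝕜] H))ᗮ = ⊥ := by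
    rw [Submodule.eq_bot_iff]
    intro y hy
    have hy0 : inner 𝕜 (V y - y) y = 0 := hy _ ⟨y, rfl⟩
    have hle : ‖V y‖ ≤ ‖y‖ := by simpa using ContinuousLinearMap.le_of_opNorm_le _ hV y
    have hVy : V y = y := by
      -- Pythagoras: `Vy - y` is orthogonal to `y`, so `‖Vy‖ ≤ ‖y‖` leaves no room for `Vy - y`.
      have h2 : ‖V y‖ ^ 2 = ‖V y - y‖ ^ 2 + ‖y‖ ^ 2 := by
        conv_lhs => rw [← sub_add_cancel (V y) y]
        rw [@norm_add_sq 𝕜, hy0]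
        simp
      have h3 : ‖V y‖ ^ 2 ≤ ‖y‖ ^ 2 := by gcongr
      have h4 : ‖V y - y‖ ^ 2 ≤ 0 := by linarith
      exact sub_eq_zero.1 (norm_eq_zero.1 (pow_eq_zero_iff two_ne_zero |>.1
        (le_antisymm h4 (sq_nonneg _))))
    by_contra hne
    exact h1 (Module.End.hasEigenvalue_of_hasEigenvector (x := y)
      ⟨Module.End.mem_eigenspace_iff.2 (by simpa using hVy), hne⟩)
  have := Submodule.topologicalClosure_eq_top_iff.2 hbot
  rw [← Submodule.dense_iff_topologicalClosure_eq_top] at this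
  exact this

/-- The Yosida-type approximants `-(I + V_r) / (2 r)` of `(V + I)(V - I)⁻¹`. -/
noncomputable def cayleyApprox (V : H →L[𝕜] H) (r : ℝ) : H →L[𝕜] H :=
  (((2 * r)⁻¹ : ℝ) : 𝕜) • (-(1 + cayleyRescale V r))

theorem cayleyApprox_expContractive {V : H →L[𝕜] H} (hV : ‖V‖ ≤ 1) {r : ℝ} (hr : 0 < r) :
    ExpContractive (cayleyApprox V r) := by
  intro t ht
  rw [cayleyApprox, smul_smul, ← RCLike.ofReal_mul]
  exact norm_exp_smul_sub_one_le (norm_cayleyRescale_le hV hr) (by positivity)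

theorem cayleyApprox_apply {V : H →L[𝕜] H} (hV : ‖V‖ ≤ 1) {r : ℝ} (hr : 0 < r) (z : H) :
    cayleyApprox V r z = -(V (cayleyInv V r z) + cayleyInv V r z) := by
  have h0 : (r : 𝕜) ≠ 0 := by exact_mod_cast hr.ne'
  have h := cayleyInv_apply_right hV hr z
  set w := cayleyInv V r z with hw
  have e : cayleyApprox V r z = (((2 * r)⁻¹ : ℝ) : 𝕜) •
      (-(z + (((r + 1 : ℝ) : 𝕜) • V w + ((r - 1 : ℝ) : 𝕜) • w))) := by
    simp [cayleyApprox, cayleyRescale, hw]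
  rw [e, ← h]
  push_cast
  match_scalars <;> field_simp <;> ring

theorem norm_smul_cayleyApprox_apply_le {V : H →L[𝕜] H} (hV : ‖V‖ ≤ 1) {r : ℝ} (hr : 0 < r)
    (z : H) : ‖(r : 𝕜) • cayleyApprox V r z‖ ≤ ‖z‖ := by
  have h1 : ‖cayleyRescale V r z‖ ≤ ‖z‖ := by
    simpa using ContinuousLinearMap.le_of_opNorm_le _ (norm_cayleyRescale_le hV hr) z
  have e : (r : 𝕜) • cayleyApprox V r z = ((2⁻¹ : ℝ) : 𝕜) • (-(z + cayleyRescale V r z)) := by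
    rw [cayleyApprox, smul_apply, smul_smul, ← RCLike.ofReal_mul]
    congr 3
    field_simp
  rw [e, norm_smul, RCLike.norm_ofReal, abs_of_pos (by norm_num), norm_neg]
  have := norm_add_le z (cayleyRescale V r z)
  linarith

/-- The Yosida identity `A_r x = Ax + r A_r Ax` at `x = Vz - z`; it reduces convergence to `r A_r →
0` strongly. -/
theorem cayleyApprox_sub_apply {V : H →L[𝕜] H} (hV : ‖V‖ ≤ 1) {r : ℝ} (hr : 0 < r) (z : H) :
    cayleyApprox V r (V z - z) = V z + z + (r : 𝕜) • cayleyApprox V r (V z + z) := by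
  have e : V z - z = (r : 𝕜) • (V z + z)
      - (((r + 1 : ℝ) : 𝕜) • z + ((r - 1 : ℝ) : 𝕜) • V z) := by
    push_cast
    module
  rw [e, map_sub, map_smul, cayleyApprox_apply hV hr (_ + _ : H), cayleyApprox_apply hV hr (_ + _ : H),
    cayleyInv_apply_left hV hr]
  abel

theorem tendsto_cayleyApprox {V : H →L[𝕜] H} (hV : ‖V‖ ≤ 1)
    (h1 : ¬ Module.End.HasEigenvalue (V : H →ₗ[𝕜] H) 1) {r : ℕ → ℝ} (hr : ∀ n, 0 < r n)
    (hr0 : Tendsto r atTop (𝓝 0)) (z : H) :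
    Tendsto (fun n => cayleyApprox V (r n) (V z - z)) atTop (𝓝 (V z + z)) := by
  -- The operators `r A_r` are contractions and are `O(r)` on the dense range of `V - I`.
  have hzero : ∀ y : H, Tendsto (fun n => (r n : 𝕜) • cayleyApprox V (r n) y) atTop (𝓝 0) := by
    intro y
    rw [Metric.tendsto_atTop]
    intro ε hε
    obtain ⟨w, hw⟩ := (denseRange_sub_one hV h1).exists_dist_lt y (show 0 < ε / 2 by positivity)
    rw [dist_eq_norm] at hw
    have hc : Tendsto (fun n => r n * (2 * ‖V w + w‖)) atTop (𝓝 (0 * (2 * ‖V w + w‖))) :=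
      hr0.mul_const _
    rw [zero_mul] at hc
    obtain ⟨N, hN⟩ := eventually_atTop.1 (hc.eventually_lt_const (show 0 < ε / 2 by positivity))
    refine ⟨N, fun n hn => ?_⟩
    have h2 := norm_smul_cayleyApprox_apply_le hV (hr n) (y - (V w - w))
    have h3 := norm_smul_cayleyApprox_apply_le hV (hr n) (V w + w)
    have h4 : ‖(r n : 𝕜) • cayleyApprox V (r n) (V w - w)‖ ≤ r n * (2 * ‖V w + w‖) := by
      rw [cayleyApprox_sub_apply hV (hr n), norm_smul, RCLike.norm_ofReal, abs_of_pos (hr n)]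
      gcongr
      · exact (hr n).le
      · refine (norm_add_le _ _).trans ?_
        linarith
    have e : (r n : 𝕜) • cayleyApprox V (r n) y = (r n : 𝕜) • cayleyApprox V (r n) (y - (V w - w))
        + (r n : 𝕜) • cayleyApprox V (r n) (V w - w) := by
      rw [← smul_add, ← map_add, sub_add_cancel]
    rw [dist_zero_right, e]
    have h5 := hN n hn
    refine (norm_add_le_of_le h2 h4).trans_lt ?_
    linarith
  simp only [fun n => cayleyApprox_sub_apply hV (hr n) z]
  simpa using (hzero (V z + z)).const_add (V z + z)

theorem exists_isCogenerator {V : H →L[𝕜] H} (hV : ‖V‖ ≤ 1)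
    (h1 : ¬ Module.End.HasEigenvalue (V : H →ₗ[𝕜] H) 1) :
    ∃ S : C0Semigroup 𝕜 H, S.IsContractive ∧ S.IsCogenerator V := by
  have hr : ∀ n : ℕ, (0 : ℝ) < 1 / ((n : ℝ) + 1) := fun n => by positivity
  have htend := tendsto_cayleyApprox hV h1 hr tendsto_one_div_add_atTop_nhds_zero_nat
  obtain ⟨S, hS, hgen⟩ := exists_contractive_semigroup
    (A := fun n : ℕ => cayleyApprox V (1 / ((n : ℝ) + 1)))
    (fun n => cayleyApprox_expContractive hV (hr n))
    (fun m n => (((Commute.one_left _).add_left ((Commute.one_right _).add_right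
      (commute_cayleyRescale V _ _))).neg_left.neg_right.smul_left _).smul_right _)
    ((denseRange_sub_one hV h1).mono (by rintro _ ⟨z, rfl⟩; exact ⟨_, htend z⟩))
  have hmem : ∀ z, (V z - z, V z + z) ∈ S.generator.graph := fun z => by
    rw [S.generator_graph]
    exact hgen _ _ (htend z)
  have hrep : ∀ x : S.generator.domain, ∃ z,
      (x : H) = V z - z ∧ S.generator x = V z + z := by
    intro x
    -- Subtracting the two required equations forces this `z`.
    refine ⟨(2 : 𝕜)⁻¹ • (S.generator x - x), ?_⟩
    set z : H := (2 : 𝕜)⁻¹ • (S.generator x - x) with hz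
    have h2 : S.generator x - x = (2 : 𝕜) • z := by
      rw [hz, smul_inv_smul₀ two_ne_zero]
    have hd := S.generator.graph.sub_mem (S.generator.mem_graph x) (hmem z)
    rw [S.generator_graph] at hd
    have hle := hS.re_inner_le (x := (x : H) - (V z - z)) (y := S.generator x - (V z + z)) hd
    -- The difference of the two graph elements has the form `(d, d)`; dissipativity gives `‖d‖² ≤
    -- 0`.
    have h3 : S.generator x - (V z + z) = x - (V z - z) := by
      rw [two_smul] at h2
      rw [sub_eq_iff_eq_add] at h2
      rw [h2]
      abel
    rw [h3, inner_self_eq_norm_sq] at hle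
    have h4 : (x : H) - (V z - z) = 0 :=
      norm_eq_zero.1 (pow_eq_zero_iff two_ne_zero |>.1 (le_antisymm hle (sq_nonneg _)))
    exact ⟨sub_eq_zero.1 h4, sub_eq_zero.1 (h3.trans h4)⟩
  -- For `x = Vz - z`, `x - Ax = -2z`, so the resolvent at `1` is `(I - V)/2`.
  refine ⟨S, hS, ⟨(2 : 𝕜)⁻¹ • (1 - V), fun x => ?_, fun y => ?_⟩, fun x => ?_⟩
  · obtain ⟨z, hx, hy⟩ := hrep x
    rw [hy, hx]
    simp
    module
  · obtain ⟨x, hx, hy⟩ := (LinearPMap.mem_graph_iff _).1 (hmem (-((2 : 𝕜)⁻¹ • y)))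
    refine ⟨x, ?_, ?_⟩
    · rw [hx]
      simp
      module
    · rw [hy, hx]
      simp
      module
  · obtain ⟨z, hx, hy⟩ := hrep x
    rw [hy, hx]
    simp

end HilbertSpace

end CogeneratorTheory

theorem corollary3p2 {𝕜 H : Type*} [RCLike 𝕜] [NormedAddCommGroup H] [InnerProductSpace 𝕜 H]
    [CompleteSpace H] :
    (∀ V : H →L[𝕜] H,
      (∃ S : CogeneratorTheory.C0Semigroup 𝕜 H, S.IsContractive ∧ S.IsCogenerator V) ↔
        (‖V‖ ≤ 1 ∧ ¬ Module.End.HasEigenvalue (V : H →ₗ[𝕜] H) 1)) ∧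
    (∀ (A : H →ₗ.[𝕜] H) (σ τ : ℝ), 0 < σ → 0 < τ →
      (∃ W : H →L[𝕜] H, CogeneratorTheory.IsCayleyTransform A σ W ∧ ‖W‖ ≤ 1) →
        ∃ W : H →L[𝕜] H, CogeneratorTheory.IsCayleyTransform A τ W ∧ ‖W‖ ≤ 1) := by
  refine ⟨fun V => ⟨?_, fun h => CogeneratorTheory.exists_isCogenerator h.1 h.2⟩, ?_⟩
  · rintro ⟨S, hS, hV⟩
    exact ⟨hV.norm_le_one hS, hV.not_hasEigenvalue_one⟩
  · rintro A σ τ hσ hτ ⟨W, hW, hn⟩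
    exact ⟨_, hW.rescale hσ hτ hn,
      CogeneratorTheory.norm_cayleyRescale_le hn (div_pos hτ hσ)⟩
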